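/- For a finite set $V\subset\mathbb R^d$, call two distinct points $p,q\in V$ a double-normal pair if $V$ lies (weakly) between the two hyperplanes through $p$ and through $q$ that are orthogonal to the segment $pq$. The double-normal graph of $V$ has vertex set $V$, and its edges are the double-normal pairs. For $d\ge 1$, let $k(d)$ be the largest integer $k$ such that for every $r\in\mathbb N$ some double-normal graph of a finite set in $\mathbb R^d$ contains, as a (not necessarily induced) subgraph, the complete $k$-partite graph with all parts of size $r$. Let $D(m)$ be the least dimension $n$ for which there are $m$ distinct points in $\mathbb R^n$ that form only non-obtuse angles. Theorem. Let $d\ge 1$. The largest integer $k=k(d)$ exists, and there is a family of (not necessarily distinct) unit vectors $u_{ij}\in\mathbb R^d$, $i,j=1,\dots,k$, such that (1) the vectors $u_{11},\dots,u_{kk}$ are pairwise orthogonal; (2) $u_{ii}$ is orthogonal to $u_{jl}$ for all $i,j,l\in\{1,\dots,k\}$ with $j\ne l$ (where $i=j$ and $i=l$ are allowed); (3) $\dim\operatorname{lin}\{u_{sl} : s,l=1,\dots,k,\ s\neq l\}\ge\log_2 k$. Consequently $k(d)+D(k(d))\le d$ and $k(d)+\log_2 k(d)\le d$. -/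

import Mathlib

open scoped RealInnerProductSpace

/-- The double-normal graph of a finite point set `V` in Euclidean `d`-space. Two distinct points
`p`, `q` of `V` are adjacent iff `V` lies (weakly) between the two hyperplanes orthogonal to
`q - p` that pass through `p` and through `q`. -/
def doubleNormalGraph {d : ℕ} (V : Finset (EuclideanSpace ℝ (Fin d))) : SimpleGraph V where
  Adj p q := p ≠ q ∧ ∀ x ∈ V,
    ⟪q.1 - p.1, p.1⟫ ≤ ⟪q.1 - p.1, x⟫ ∧ ⟪q.1 - p.1, x⟫ ≤ ⟪q.1 - p.1, q.1⟫
  symm := ⟨by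
    rintro p q ⟨hpq, h⟩
    refine ⟨hpq.symm, fun x hx => ?_⟩
    obtain ⟨h1, h2⟩ := h x hx
    rw [← neg_sub q.1 p.1]
    simp only [inner_neg_left]
    exact ⟨neg_le_neg h2, neg_le_neg h1⟩⟩
  loopless := ⟨fun _ h => h.1 rfl⟩

/-- The set of all `k` such that for every `r` some double-normal graph of a finite set in
Euclidean `d`-space contains the complete `k`-partite graph with all parts of size `r`
as a (not necessarily induced) subgraph. -/
def multipartiteOrders (d : ℕ) : Set ℕ :=
  {k | ∀ r : ℕ, ∃ V : Finset (EuclideanSpace ℝ (Fin d)),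
    (SimpleGraph.completeEquipartiteGraph k r).IsContained (doubleNormalGraph V)}

/-- The number `k(d)`: the largest element of `multipartiteOrders d`. -/
noncomputable def kDoubleNormal (d : ℕ) : ℕ := sSup (multipartiteOrders d)

/-- The dimensions `n` in which there are `m` distinct points that form only non-obtuse angles. -/
def nonObtuseDims (m : ℕ) : Set ℕ :=
  {n | ∃ p : Fin m → EuclideanSpace ℝ (Fin n), Function.Injective p ∧
    ∀ i j l : Fin m, i ≠ j → j ≠ l → i ≠ l →
      EuclideanGeometry.angle (p i) (p j) (p l) ≤ Real.pi / 2}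

/-- `D(m)`: the least dimension in which there are `m` points that form only non-obtuse angles. -/
noncomputable def nonObtuseDim (m : ℕ) : ℕ := sInf (nonObtuseDims m)

/-- The minimum in the definition of `nonObtuseDim` is over a non-empty set (the vertices of a
regular simplex form only angles of measure `π / 3`). -/
theorem nonObtuseDim_isLeast (m : ℕ) : IsLeast (nonObtuseDims m) (nonObtuseDim m) := by
  have hm : m ∈ nonObtuseDims m := by
    refine ⟨fun i => EuclideanSpace.single i (1 : ℝ), fun i j h => ?_, fun i j l hij hjl hil => ?_⟩
    · by_contra hne
      have := congrArg (fun v : EuclideanSpace ℝ (Fin m) => v i) h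
      simp [hne] at this
    · unfold EuclideanGeometry.angle
      rw [InnerProductGeometry.angle, Real.arccos_le_pi_div_two]
      refine div_nonneg ?_ (by positivity)
      simp [inner_sub_left, inner_sub_right, EuclideanSpace.inner_single_left, hij, hjl,
        hil]
  exact ⟨Nat.sInf_mem ⟨m, hm⟩, fun n hn => Nat.sInf_le hn⟩

/-!
Why the theorem holds. Let `W 1, …, W k` be the parts of a complete `k`-partite subgraph of a
double-normal graph. If `x`, `b` lie in one part and `y`, `z` are points of the other parts or equal
to `b`, then `|⟪x - b, y - z⟫|` is at most `‖x - b‖ ^ 2` and, when `y`, `z` form a double-normal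
pair or lie in one other part, at most `‖y - z‖ ^ 2`. So the angle between `x - b` and `y - z` is almost right as soon as the
two lengths have very different orders of magnitude. By a pigeonhole argument a large part has a
point `b i` from which distances of many scales occur, so `x i` can be chosen with `‖x i - b i‖`
far in scale from every `‖b j - b l‖` and every other `‖x j - b j‖`
(`exists_scaleSeparated_pairs`, `exists_almost_orthogonal_directions`). As the parts grow, a
subsequence of the directions of `x i - b i` and of `b j - b l` converges to the vectors `u i i` and
`u j l`, with exact orthogonality in the limit.

The bound `k ≤ 2 ^ dim` for the span of the `u j l` with `j ≠ l` holds because the points `b i` form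
only non-obtuse angles. The Danzer–Grünbaum volume argument (`IsNonObtuse.card_le`) gives such a
bound for a fixed configuration; `card_le_two_pow_of_tendsto_direction` extends it to limits of
directions by splitting the points into clusters, whose inner directions are orthogonal to the span
of the differences of the cluster positions.

Since `u 1 1, …, u k k` are orthonormal and orthogonal to that span, `k + dim ≤ d`. This bounds `k`,
so the maximum exists, and the two final inequalities follow from `k ≤ 2 ^ dim`: for the one on
non-obtuse angles, take `k` vertices of a cube (`nonObtuseDim_le`).
-/

/-! ### Non-obtuse configurations and the Danzer–Grünbaum bound -/

/-- The points `q s` form only non-obtuse angles, where the angle condition is written as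
`0 ≤ ⟪q s - q l, q m - q l⟫`. It holds trivially for triples with `s = l`, `m = l` or `s = m`,
so all triples are allowed. -/
def IsNonObtuse {ι E : Type*} [NormedAddCommGroup E] [InnerProductSpace ℝ E] (q : ι → E) : Prop :=
  ∀ s l m, 0 ≤ ⟪q s - q l, q m - q l⟫

section DanzerGrunbaum

open MeasureTheory Module Set Filter Topology
open scoped Pointwise

variable {ι E : Type*} [NormedAddCommGroup E] [InnerProductSpace ℝ E]

theorem IsNonObtuse.le_inner_of_mem_convexHull {q : ι → E} (h : IsNonObtuse q) (s t : ι) {y : E}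
    (hy : y ∈ convexHull ℝ (range q)) : ⟪q t - q s, q s⟫ ≤ ⟪q t - q s, y⟫ := by
  have hc : Convex ℝ {w : E | ⟪q t - q s, q s⟫ ≤ ⟪q t - q s, w⟫} :=
    convex_halfSpace_ge (innerₛₗ ℝ (q t - q s)).isLinear _
  refine convexHull_min ?_ hc hy
  rintro _ ⟨m, rfl⟩
  have := h t s m
  rw [inner_sub_right] at this
  exact sub_nonneg.mp this

theorem IsNonObtuse.lt_inner_of_mem_interior {q : ι → E} (h : IsNonObtuse q) {s t : ι}
    (hst : q t ≠ q s) {y : E} (hy : y ∈ interior (convexHull ℝ (range q))) :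
    ⟪q t - q s, q s⟫ < ⟪q t - q s, y⟫ := by
  have hlim : Tendsto (fun c : ℝ => y - c • (q t - q s)) (𝓝[>] 0) (𝓝 y) := by
    have : Continuous fun c : ℝ => y - c • (q t - q s) := by fun_prop
    simpa using (this.tendsto 0).mono_left nhdsWithin_le_nhds
  obtain ⟨c, hc, hc0⟩ :=
    ((hlim.eventually (mem_interior_iff_mem_nhds.mp hy)).and self_mem_nhdsWithin).exists
  have h1 := h.le_inner_of_mem_convexHull s t hc
  rw [inner_sub_right, real_inner_smul_right, real_inner_self_eq_norm_sq] at h1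
  have h2 : 0 < ‖q t - q s‖ := norm_pos_iff.mpr (sub_ne_zero.mpr hst)
  have h3 : 0 < c * ‖q t - q s‖ ^ 2 := mul_pos hc0 (by positivity)
  linarith

/-- The Danzer–Grünbaum bound for a full-dimensional configuration: with `P` the convex hull of the
points, the translates `q s + interior P` are pairwise disjoint and lie in `2 • interior P`, so
comparing volumes bounds their number. -/
theorem IsNonObtuse.card_le_of_vectorSpan_eq_top [Fintype ι] [FiniteDimensional ℝ E] {q : ι → E}
    (h : IsNonObtuse q) (hq : Function.Injective q) (htop : vectorSpan ℝ (range q) = ⊤) :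
    Fintype.card ι ≤ 2 ^ finrank ℝ E := by
  rcases isEmpty_or_nonempty ι with hι | hι
  · simp
  borelize E
  set U := interior (convexHull ℝ (range q)) with hU
  have hPc : Convex ℝ (convexHull ℝ (range q)) := convex_convexHull ℝ _
  have hUne : U.Nonempty := by
    rw [hU, interior_convexHull_nonempty_iff_affineSpan_eq_top,
      AffineSubspace.affineSpan_eq_top_iff_vectorSpan_eq_top_of_nonempty ℝ E E (range_nonempty q)]
    exact htop
  have hUpos : (volume : Measure E) U ≠ 0 := (isOpen_interior.measure_pos _ hUne).ne'
  have hUfin : (volume : Measure E) U ≠ ⊤ := by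
    refine (Bornology.IsBounded.measure_lt_top (Bornology.IsBounded.subset ?_ interior_subset)).ne
    exact isBounded_convexHull.mpr (finite_range q).isBounded
  have hdisj : Pairwise (Function.onFun Disjoint fun s => q s +ᵥ U) := by
    intro s t hst
    rw [Function.onFun, Set.disjoint_left]
    rintro _ ⟨y, hy, rfl⟩ ⟨y', hy', he⟩
    have he' : q t + y' = q s + y := he
    have h1 := h.lt_inner_of_mem_interior (hq.ne hst) hy
    have h2 := h.lt_inner_of_mem_interior (hq.ne hst.symm) hy'
    have h3 := congrArg (fun z => ⟪q t - q s, z⟫) he'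
    simp only [inner_add_right, inner_sub_left] at h1 h2 h3
    linarith
  have hsub : (⋃ s, q s +ᵥ U) ⊆ (2 : ℝ) • U := by
    refine iUnion_subset fun s => ?_
    rintro _ ⟨y, hy, rfl⟩
    refine ⟨(1 / 2 : ℝ) • q s + (1 / 2 : ℝ) • y, ?_, ?_⟩
    · exact hPc.combo_self_interior_mem_interior
        (subset_convexHull ℝ _ (mem_range_self s)) hy (by norm_num) (by norm_num) (by norm_num)
    · simp only [vadd_eq_add, smul_add, smul_smul]
      norm_num
  have hvol := measure_mono (μ := (volume : Measure E)) hsub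
  rw [measure_iUnion hdisj fun s => (isOpen_interior.vadd (q s)).measurableSet,
    Measure.addHaar_smul] at hvol
  simp only [measure_vadd, tsum_fintype, Finset.sum_const, Finset.card_univ, nsmul_eq_mul] at hvol
  rw [ENNReal.mul_le_mul_iff_left hUpos hUfin, abs_of_nonneg (by positivity),
    ENNReal.ofReal_pow (by norm_num)] at hvol
  norm_num at hvol
  exact_mod_cast hvol

/-- The Danzer–Grünbaum bound: distinct points that form only non-obtuse angles and span an
`n`-dimensional affine space are at most `2 ^ n` in number. -/
theorem IsNonObtuse.card_le [Fintype ι] [FiniteDimensional ℝ E] {q : ι → E}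
    (h : IsNonObtuse q) (hq : Function.Injective q) :
    Fintype.card ι ≤ 2 ^ finrank ℝ (vectorSpan ℝ (range q)) := by
  rcases isEmpty_or_nonempty ι with hι | ⟨⟨a⟩⟩
  · simp
  set W := vectorSpan ℝ (range q) with hW
  let q' : ι → W := fun s => ⟨q s - q a, vsub_mem_vectorSpan ℝ (mem_range_self s) (mem_range_self a)⟩
  refine IsNonObtuse.card_le_of_vectorSpan_eq_top (q := q') (fun s l m => ?_) (fun s t hst => ?_) ?_
  · have := h s l m
    simpa [q', Submodule.coe_inner] using this
  · exact hq (by simpa [q'] using hst)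
  · rw [eq_top_iff]
    rintro ⟨w, hw⟩ -
    rw [hW, vectorSpan_range_eq_span_range_vsub_right ℝ q a] at hw
    rw [vectorSpan_range_eq_span_range_vsub_right ℝ q' a]
    have : w ∈ (Submodule.span ℝ (range fun i => q' i -ᵥ q' a)).map W.subtype := by
      rw [Submodule.map_span, ← range_comp]
      convert hw using 3
      ext i
      simp [q']
    obtain ⟨z, hz, hzw⟩ := this
    have : z = ⟨w, by rw [hW, vectorSpan_range_eq_span_range_vsub_right ℝ q a]; exact hw⟩ :=
      Subtype.ext hzw
    rwa [this] at hz

end DanzerGrunbaum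

/-! ### Non-obtuse configurations with convergent directions -/

section Limits

open Module Set Filter Topology

variable {E : Type*} [NormedAddCommGroup E] [InnerProductSpace ℝ E]

/-- The unit vector in the direction of `v` (and `0` if `v = 0`). -/
noncomputable def direction (v : E) : E := ‖v‖⁻¹ • v

theorem norm_direction {v : E} (hv : v ≠ 0) : ‖direction v‖ = 1 := by
  rw [direction, norm_smul, norm_inv, norm_norm, inv_mul_cancel₀ (norm_ne_zero_iff.mpr hv)]

theorem direction_neg (v : E) : direction (-v) = -direction v := by
  simp [direction]

theorem direction_smul {c : ℝ} (hc : 0 < c) (v : E) : direction (c • v) = direction v := by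
  rw [direction, direction, norm_smul, Real.norm_of_nonneg hc.le, mul_inv, smul_smul]
  congr 1
  field_simp

theorem inner_direction (v w : E) : ⟪direction v, direction w⟫ = ‖v‖⁻¹ * (‖w‖⁻¹ * ⟪v, w⟫) := by
  simp only [direction, real_inner_smul_left, real_inner_smul_right]
  ring

theorem tendsto_direction {α : Type*} {l : Filter α} {f : α → E} {v : E} (hv : v ≠ 0)
    (hf : Tendsto f l (𝓝 v)) : Tendsto (fun a => direction (f a)) l (𝓝 (direction v)) :=
  (hf.norm.inv₀ (norm_ne_zero_iff.mpr hv)).smul hf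

/-- The linear span of the vectors `u s l` with `s ≠ l`. -/
def offDiagSpan {ι : Type*} (u : ι → ι → E) : Submodule ℝ E :=
  Submodule.span ℝ {v | ∃ s l, s ≠ l ∧ v = u s l}

theorem mem_offDiagSpan {ι : Type*} (u : ι → ι → E) {s l : ι} (h : s ≠ l) :
    u s l ∈ offDiagSpan u :=
  Submodule.subset_span ⟨s, l, h, rfl⟩

/-- Non-obtuse configurations of distinct points whose directions converge to `u s l` have at most
`2 ^ n` points, where `n` is the dimension of the span of the limit directions. The limit directions
do not determine a non-obtuse configuration in that span, since points may merge at very different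
rates. After rescaling to a bounded non-constant configuration and passing to a limit `q`, the
distinct points among the `q s` obey the Danzer–Grünbaum bound in their span `M`, while the limit
directions inside a fibre of `q` are orthogonal to `M`, so each fibre is bounded by induction. -/
theorem card_le_two_pow_of_tendsto_direction [FiniteDimensional ℝ E] :
    ∀ (n : ℕ) {ι : Type} [Fintype ι], Fintype.card ι = n → ∀ (p : ℕ → ι → E) (u : ι → ι → E),
      (∀ N, IsNonObtuse (p N)) → (∀ N, Function.Injective (p N)) →
      (∀ s l, s ≠ l → Tendsto (fun N => direction (p N s - p N l)) atTop (𝓝 (u s l))) →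
      Fintype.card ι ≤ 2 ^ finrank ℝ (offDiagSpan u) := by
  classical
  intro n
  induction n using Nat.strong_induction_on with
  | _ n ih =>
  intro ι _ hn p u hp hinj hu
  rcases subsingleton_or_nontrivial ι with hι | hι
  · exact (Fintype.card_le_one_iff_subsingleton.mpr hι).trans Nat.one_le_two_pow
  obtain ⟨a⟩ : Nonempty ι := inferInstance
  -- Rescale by the sup norm of the configuration, seen from the point with index `a`.
  let w : ℕ → ι → E := fun N s => p N s - p N a
  have hw0 : ∀ N, w N ≠ 0 := by
    intro N h
    obtain ⟨b, hb⟩ := exists_ne a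
    exact hb (hinj N (sub_eq_zero.mp (congrFun h b)))
  have hwpos : ∀ N, 0 < ‖w N‖⁻¹ := fun N => inv_pos.mpr (norm_pos_iff.mpr (hw0 N))
  obtain ⟨q, hq, φ, hφ, hlim⟩ := (isCompact_sphere (0 : ι → E) 1).tendsto_subseq
    (x := fun N => ‖w N‖⁻¹ • w N) (fun N => by
      rw [mem_sphere_zero_iff_norm, norm_smul, norm_inv, norm_norm,
        inv_mul_cancel₀ (norm_ne_zero_iff.mpr (hw0 N))])
  have hlim' : ∀ s, Tendsto (fun N => ‖w (φ N)‖⁻¹ • w (φ N) s) atTop (𝓝 (q s)) :=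
    fun s => (tendsto_pi_nhds.mp hlim) s
  have hdiff : ∀ s l, Tendsto (fun N => ‖w (φ N)‖⁻¹ • (p (φ N) s - p (φ N) l)) atTop
      (𝓝 (q s - q l)) := by
    intro s l
    refine ((hlim' s).sub (hlim' l)).congr fun N => ?_
    rw [← smul_sub]
    simp [w]
  have hqno : IsNonObtuse q := by
    intro s l m
    refine ge_of_tendsto' ((hdiff s l).inner (hdiff m l)) fun N => ?_
    rw [real_inner_smul_left, real_inner_smul_right]
    exact mul_nonneg (hwpos _).le (mul_nonneg (hwpos _).le (hp _ s l m))
  have hqa : q a = 0 := by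
    refine tendsto_nhds_unique (hlim' a) ?_
    simp [w]
  obtain ⟨b, hb⟩ : ∃ b, q b ≠ 0 := by
    by_contra! h
    have h0 : q = 0 := funext h
    simp [h0] at hq
  have hune : ∀ s l, q s ≠ q l → u s l = direction (q s - q l) := by
    intro s l h
    have hsl : s ≠ l := fun h' => h (congrArg q h')
    refine tendsto_nhds_unique ((hu s l hsl).comp hφ.tendsto_atTop) ?_
    refine (tendsto_direction (sub_ne_zero.mpr h) (hdiff s l)).congr fun N => ?_
    exact direction_smul (hwpos _) _
  have hanti : ∀ s l, s ≠ l → u l s = -u s l := by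
    intro s l h
    refine tendsto_nhds_unique (hu l s h.symm) ((hu s l h).neg.congr fun N => ?_)
    rw [← direction_neg, neg_sub]
  have huno : ∀ s l m, s ≠ l → m ≠ l → 0 ≤ ⟪u s l, u m l⟫ := by
    intro s l m hs hm
    refine ge_of_tendsto' ((hu s l hs).inner (hu m l hm)) fun N => ?_
    rw [inner_direction]
    have := hp N s l m
    positivity
  set M := vectorSpan ℝ (range q) with hM
  have hML : M ≤ offDiagSpan u := by
    rw [hM, vectorSpan_range_eq_span_range_vsub_right ℝ q a, Submodule.span_le]
    rintro _ ⟨s, rfl⟩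
    change q s - q a ∈ offDiagSpan u
    by_cases h : q s = q a
    · rw [h, sub_self]
      exact zero_mem _
    · have hm : u s a ∈ offDiagSpan u := mem_offDiagSpan u fun h' => h (congrArg q h')
      rw [hune s a h, direction] at hm
      have := Submodule.smul_mem _ ‖q s - q a‖ hm
      rwa [smul_smul, mul_inv_cancel₀ (norm_ne_zero_iff.mpr (sub_ne_zero.mpr h)), one_smul] at this
  -- A direction inside a fibre makes non-obtuse angles at both ends with the direction to a point of
  -- another fibre, and the latter is the same from both ends in the limit.
  have horth : ∀ s l, s ≠ l → q s = q l → ∀ m, ⟪u s l, q m - q l⟫ = 0 := by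
    intro s l hsl hqsl m
    by_cases h : q m = q l
    · simp [h]
    have hml : m ≠ l := fun h' => h (congrArg q h')
    have hms : m ≠ s := fun h' => h (h' ▸ hqsl)
    have h1 := huno s l m hsl hml
    have h2 := huno l s m hsl.symm hms
    rw [hanti s l hsl, hune m s (by rwa [hqsl]), hqsl, inner_neg_left] at h2
    rw [hune m l h] at h1
    rw [direction, real_inner_smul_right] at h1 h2
    have h3 : 0 < ‖q m - q l‖⁻¹ := inv_pos.mpr (norm_pos_iff.mpr (sub_ne_zero.mpr h))
    have h4 : ‖q m - q l‖⁻¹ * ⟪u s l, q m - q l⟫ = 0 := by linarith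
    exact (mul_eq_zero.mp h4).resolve_left h3.ne'
  have hfib : ∀ v ∈ Finset.univ.image q, (Finset.univ.filter fun s => q s = v).card ≤
      2 ^ (finrank ℝ (offDiagSpan u) - finrank ℝ M) := by
    intro v _
    let F := {s // q s = v}
    have hcard : Fintype.card F = (Finset.univ.filter fun s => q s = v).card :=
      Fintype.card_subtype _
    have hlt : Fintype.card F < n := by
      rw [← hn]
      by_cases hv : q a = v
      · exact Fintype.card_subtype_lt (x := b) fun h => hb (by rw [h, ← hv, hqa])
      · exact Fintype.card_subtype_lt (x := a) hv
    have hF := ih _ hlt (ι := F) rfl (fun N s => p N s) (fun s l => u s l)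
      (fun N s l m => hp N s l m) (fun N => (hinj N).comp Subtype.val_injective)
      (fun s l h => hu s l (Subtype.coe_injective.ne h))
    rw [← hcard]
    refine hF.trans (Nat.pow_le_pow_right two_pos (Nat.le_sub_of_add_le ?_))
    set K := offDiagSpan fun s l : F => u s l with hK
    have hKL : K ≤ offDiagSpan u := by
      rw [hK, offDiagSpan, Submodule.span_le]
      rintro _ ⟨s, l, h, rfl⟩
      exact mem_offDiagSpan u (Subtype.coe_injective.ne h)
    have hKM : K ⟂ M := by
      rw [hK, hM, offDiagSpan, vectorSpan_range_eq_span_range_vsub_right ℝ q a,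
        Submodule.isOrtho_span]
      rintro _ ⟨s, l, h, rfl⟩ _ ⟨m, rfl⟩
      have hsl : (s : ι) ≠ l := Subtype.coe_injective.ne h
      have e := horth s l hsl (s.2.trans l.2.symm)
      have h1 := e m
      have h2 := e a
      change ⟪u s l, q m - q a⟫ = 0
      rw [inner_sub_right] at h1 h2 ⊢
      linarith
    have hsup := Submodule.finrank_sup_add_finrank_inf_eq K M
    rw [hKM.disjoint.eq_bot, finrank_bot, add_zero] at hsup
    rw [← hsup]
    exact Submodule.finrank_mono (sup_le hKL hML)
  have himg : (Finset.univ.image q).card ≤ 2 ^ finrank ℝ M := by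
    have h1 : IsNonObtuse (fun v : Finset.univ.image q => (v : E)) := by
      rintro ⟨_, hs⟩ ⟨_, hl⟩ ⟨_, hm⟩
      obtain ⟨s, -, rfl⟩ := Finset.mem_image.mp hs
      obtain ⟨l, -, rfl⟩ := Finset.mem_image.mp hl
      obtain ⟨m, -, rfl⟩ := Finset.mem_image.mp hm
      exact hqno s l m
    have h2 := h1.card_le Subtype.val_injective
    have h3 : range (fun v : Finset.univ.image q => (v : E)) = range q := by
      ext v
      simp
    rwa [h3, Fintype.card_coe] at h2
  calc Fintype.card ι = (Finset.univ : Finset ι).card := rfl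
    _ ≤ 2 ^ (finrank ℝ (offDiagSpan u) - finrank ℝ M) * (Finset.univ.image q).card :=
      Finset.card_le_mul_card_image _ _ hfib
    _ ≤ 2 ^ (finrank ℝ (offDiagSpan u) - finrank ℝ M) * 2 ^ finrank ℝ M :=
      Nat.mul_le_mul_left _ himg
    _ = 2 ^ finrank ℝ (offDiagSpan u) := by
      rw [← pow_add, Nat.sub_add_cancel (Submodule.finrank_mono hML)]

end Limits

/-! ### Separated scales in large finite sets -/

/-- Two lengths are `ε`-separated if one of them is at most `ε` times the other. -/
def ScaleSeparated (ε s t : ℝ) : Prop := s ≤ ε * t ∨ t ≤ ε * s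

theorem ScaleSeparated.symm {ε s t : ℝ} (h : ScaleSeparated ε s t) : ScaleSeparated ε t s :=
  Or.symm h

section Scales

open Module Set Filter Topology

variable {E : Type*} [NormedAddCommGroup E] [InnerProductSpace ℝ E]

/-- A large finite set has a point from which distances of many different scales occur, so that one
of these distances avoids any few given scales. A large set has a large part of much smaller
diameter; a distance to a point far from that part is one new scale. -/
theorem exists_forall_exists_scaleSeparated [FiniteDimensional ℝ E] {ε : ℝ} (hε : 0 < ε) (m : ℕ) :
    ∃ N : ℕ, ∀ V : Finset E, N ≤ V.card → ∃ b ∈ V, ∀ T : Finset ℝ, T.card ≤ m →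
      ∃ x ∈ V, x ≠ b ∧ ∀ t ∈ T, ScaleSeparated ε ‖x - b‖ t := by
  classical
  induction m with
  | zero =>
    refine ⟨2, fun V hV => ?_⟩
    obtain ⟨b, hb, x, hx, hne⟩ := Finset.one_lt_card.mp hV
    refine ⟨b, hb, fun T hT => ⟨x, hx, hne.symm, fun t ht => ?_⟩⟩
    rw [Finset.card_eq_zero.mp (Nat.le_zero.mp hT)] at ht
    exact absurd ht (Finset.notMem_empty t)
  | succ m ih =>
    obtain ⟨N, hN⟩ := ih
    set η := ε ^ 2 / 4 with hη
    have hη0 : 0 < η := by positivity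
    obtain ⟨C, -, hCfin, hC⟩ := (isCompact_closedBall (0 : E) 1).finite_cover_balls hη0
    refine ⟨hCfin.toFinset.card * N + 2, fun V hV => ?_⟩
    obtain ⟨v, hv, v', hv', hne⟩ := Finset.one_lt_card.mp (show 1 < V.card by omega)
    obtain ⟨y, hy, hymax⟩ := V.exists_max_image (fun y => ‖y - v‖) ⟨v, hv⟩
    set D := ‖y - v‖ with hD
    have hD0 : 0 < D :=
      (norm_pos_iff.mpr (sub_ne_zero.mpr hne.symm)).trans_le (hymax v' hv')
    have hcover : ∀ z ∈ V, ∃ c ∈ hCfin.toFinset, ‖D⁻¹ • (z - v) - c‖ < η := by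
      intro z hz
      have hz1 : D⁻¹ • (z - v) ∈ Metric.closedBall (0 : E) 1 := by
        rw [mem_closedBall_zero_iff, norm_smul, norm_inv, Real.norm_of_nonneg hD0.le,
          inv_mul_le_one₀ hD0]
        exact hymax z hz
      obtain ⟨c, hc, hzc⟩ := mem_iUnion₂.mp (hC hz1)
      exact ⟨c, hCfin.mem_toFinset.mpr hc, by rwa [← dist_eq_norm]⟩
    choose! g hgC hg using hcover
    obtain ⟨c, -, hc⟩ := Finset.exists_lt_card_fiber_of_mul_lt_card_of_maps_to (n := N) hgC (by omega)
    set V' := V.filter fun z => g z = c with hV'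
    have hdiam : ∀ z ∈ V', ∀ z' ∈ V', ‖z - z'‖ ≤ 2 * η * D := by
      intro z hz z' hz'
      obtain ⟨hzV, hzc⟩ := Finset.mem_filter.mp hz
      obtain ⟨hzV', hzc'⟩ := Finset.mem_filter.mp hz'
      have h1 := hg z hzV
      have h2 := hg z' hzV'
      rw [hzc] at h1
      rw [hzc'] at h2
      have h3 : z - z' = D • ((D⁻¹ • (z - v) - c) - (D⁻¹ • (z' - v) - c)) := by
        rw [sub_sub_sub_cancel_right, ← smul_sub, smul_smul, mul_inv_cancel₀ hD0.ne', one_smul,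
          sub_sub_sub_cancel_right]
      rw [h3, norm_smul, Real.norm_of_nonneg hD0.le]
      have h4 := norm_sub_le (D⁻¹ • (z - v) - c) (D⁻¹ • (z' - v) - c)
      nlinarith
    obtain ⟨b, hb, hbT⟩ := hN V' hc.le
    have hfar : ∃ x ∈ V, D / 2 ≤ ‖x - b‖ := by
      by_contra! h
      have h1 := norm_sub_le_norm_sub_add_norm_sub y b v
      have h2 := h y hy
      have h3 := h v hv
      rw [norm_sub_rev] at h3
      linarith
    obtain ⟨x, hx, hxb⟩ := hfar
    refine ⟨b, (Finset.mem_filter.mp hb).1, fun T hT => ?_⟩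
    by_cases hall : ∀ t ∈ T, ScaleSeparated ε ‖x - b‖ t
    · refine ⟨x, hx, fun h => ?_, hall⟩
      rw [h, sub_self, norm_zero] at hxb
      linarith
    -- A scale comparable with that of `x` is much larger than the diameter of `V'`.
    push Not at hall
    obtain ⟨t, ht, htx⟩ := hall
    obtain ⟨x', hx', hne', hsep⟩ := hbT (T.erase t) (by
      rw [Finset.card_erase_of_mem ht]
      omega)
    refine ⟨x', (Finset.mem_filter.mp hx').1, hne', fun t' ht' => ?_⟩
    by_cases h : t' = t
    · rw [h]
      left
      have h1 : ε * ‖x - b‖ < t := not_le.mp fun h' => htx (Or.inr h')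
      have h2 : ε * (D / 2) ≤ ε * ‖x - b‖ := mul_le_mul_of_nonneg_left hxb hε.le
      have h3 : ε * (ε * (D / 2)) ≤ ε * t := mul_le_mul_of_nonneg_left (h2.trans h1.le) hε.le
      refine (hdiam x' hx' b hb).trans (le_trans (le_of_eq ?_) h3)
      rw [hη]
      ring
    · exact hsep t' (Finset.mem_erase.mpr ⟨h, ht'⟩)

/-- In finitely many large finite sets, pairs `b i`, `x i` of distinct points can be chosen so that
the lengths `‖x i - b i‖` are separated from each other and from all `‖b j - b l‖`. The points
`b i` are chosen before the points `x i`, so the scales `‖b j - b l‖` to be avoided are fixed. -/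
theorem exists_scaleSeparated_pairs [FiniteDimensional ℝ E] {ι : Type*} [Fintype ι] {ε : ℝ}
    (hε : 0 < ε) : ∃ N : ℕ, ∀ W : ι → Finset E, (∀ i, N ≤ (W i).card) →
      ∃ b x : ι → E, (∀ i, b i ∈ W i) ∧ (∀ i, x i ∈ W i) ∧ (∀ i, x i ≠ b i) ∧
        (∀ i j l, ScaleSeparated ε ‖x i - b i‖ ‖b j - b l‖) ∧
        (∀ i j, i ≠ j → ScaleSeparated ε ‖x i - b i‖ ‖x j - b j‖) := by
  classical
  set n := Fintype.card ι with hn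
  obtain ⟨N, hN⟩ := exists_forall_exists_scaleSeparated (E := E) hε (n * n + n)
  refine ⟨N, fun W hW => ?_⟩
  choose b hbW hb using fun i => hN (W i) (hW i)
  have key : ∀ I : Finset ι, ∃ x : ι → E, ∀ i ∈ I, x i ∈ W i ∧ x i ≠ b i ∧
      (∀ j l, ScaleSeparated ε ‖x i - b i‖ ‖b j - b l‖) ∧
      (∀ j ∈ I, i ≠ j → ScaleSeparated ε ‖x i - b i‖ ‖x j - b j‖) := by
    intro I
    induction I using Finset.induction_on with
    | empty => exact ⟨b, by simp⟩
    | insert a I haI ih =>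
      obtain ⟨x, hx⟩ := ih
      obtain ⟨z, hzW, hzb, hz⟩ := hb a
        ((Finset.univ.image fun jl : ι × ι => ‖b jl.1 - b jl.2‖) ∪ I.image fun j => ‖x j - b j‖) (by
          refine (Finset.card_union_le _ _).trans (add_le_add ?_ ?_)
          · refine Finset.card_image_le.trans ?_
            rw [Finset.card_univ, Fintype.card_prod]
          · exact Finset.card_image_le.trans (Finset.card_le_univ I))
      have hz1 : ∀ j l, ScaleSeparated ε ‖z - b a‖ ‖b j - b l‖ := fun j l =>
        hz _ (Finset.mem_union_left _ (Finset.mem_image_of_mem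
          (fun jl : ι × ι => ‖b jl.1 - b jl.2‖) (Finset.mem_univ (j, l))))
      have hz2 : ∀ j ∈ I, ScaleSeparated ε ‖z - b a‖ ‖x j - b j‖ := fun j hj =>
        hz _ (Finset.mem_union_right _ (Finset.mem_image_of_mem (fun j => ‖x j - b j‖) hj))
      have hne : ∀ j ∈ I, j ≠ a := fun j hj h => haI (h ▸ hj)
      refine ⟨Function.update x a z, fun i hi => ?_⟩
      rcases Finset.mem_insert.mp hi with rfl | hiI
      · rw [Function.update_self]
        refine ⟨hzW, hzb, hz1, fun j hj hij => ?_⟩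
        rw [Function.update_of_ne hij.symm]
        exact hz2 j (Finset.mem_of_mem_insert_of_ne hj hij.symm)
      · obtain ⟨h1, h2, h3, h4⟩ := hx i hiI
        rw [Function.update_of_ne (hne i hiI)]
        refine ⟨h1, h2, h3, fun j hj hij => ?_⟩
        rcases Finset.mem_insert.mp hj with rfl | hjI
        · rw [Function.update_self]
          exact (hz2 i hiI).symm
        · rw [Function.update_of_ne (hne j hjI)]
          exact h4 j hjI hij
  obtain ⟨x, hx⟩ := key Finset.univ
  exact ⟨b, x, hbW, fun i => (hx i (Finset.mem_univ i)).1, fun i => (hx i (Finset.mem_univ i)).2.1,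
    fun i => (hx i (Finset.mem_univ i)).2.2.1,
    fun i j => (hx i (Finset.mem_univ i)).2.2.2 j (Finset.mem_univ j)⟩

end Scales

/-! ### Families of sets with double-normal pairs between different members -/

/-- The sets `W i` are such that any two points of different members are distinct and form a
double-normal pair of the union. Only one of the two half-space conditions is recorded: the other
one is the same condition with the two points interchanged. -/
def IsDoubleNormalFamily {ι E : Type*} [NormedAddCommGroup E] [InnerProductSpace ℝ E]
    (W : ι → Finset E) : Prop :=
  ∀ i j, i ≠ j → ∀ p ∈ W i, ∀ q ∈ W j, p ≠ q ∧ ∀ m, ∀ x ∈ W m, 0 ≤ ⟪q - p, x - p⟫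

theorem exists_isDoubleNormalFamily {d k : ℕ} (hk : k ∈ multipartiteOrders d) (r : ℕ) :
    ∃ W : Fin k → Finset (EuclideanSpace ℝ (Fin d)),
      IsDoubleNormalFamily W ∧ ∀ i, (W i).card = r := by
  classical
  obtain ⟨V, ⟨f⟩⟩ := hk r
  refine ⟨fun i => Finset.univ.image fun a : Fin r => (f.toHom (i, a)).1, ?_, fun i => ?_⟩
  · intro i j hij p hp q hq
    obtain ⟨a, -, rfl⟩ := Finset.mem_image.mp hp
    obtain ⟨c, -, rfl⟩ := Finset.mem_image.mp hq
    obtain ⟨hne, h⟩ : (doubleNormalGraph V).Adj (f.toHom (i, a)) (f.toHom (j, c)) :=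
      f.toHom.map_adj (SimpleGraph.completeEquipartiteGraph_adj.mpr hij)
    refine ⟨fun h' => hne (Subtype.ext h'), fun m x hx => ?_⟩
    obtain ⟨e, -, rfl⟩ := Finset.mem_image.mp hx
    rw [inner_sub_right]
    exact sub_nonneg.mpr (h _ (f.toHom (m, e)).2).1
  · rw [Finset.card_image_of_injective, Finset.card_univ, Fintype.card_fin]
    intro a c hac
    simpa using f.injective' (Subtype.ext hac)

section Family

open Module Set Filter Topology

variable {ι E : Type*} [NormedAddCommGroup E] [InnerProductSpace ℝ E] {W : ι → Finset E}

theorem IsDoubleNormalFamily.isNonObtuse (hW : IsDoubleNormalFamily W) {b : ι → E}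
    (hb : ∀ i, b i ∈ W i) : IsNonObtuse b := by
  intro s l m
  rcases eq_or_ne l s with rfl | h
  · simp
  · exact (hW l s h _ (hb l) _ (hb s)).2 m _ (hb m)

/-- Seen from `b`, the points of the other sets lie between the hyperplanes orthogonal to `x - b`
through `b` and `x`. -/
theorem IsDoubleNormalFamily.inner_mem_Icc (hW : IsDoubleNormalFamily W) {i j : ι} {b x y : E}
    (hb : b ∈ W i) (hx : x ∈ W i) (hy : y ∈ W j) (h : j ≠ i ∨ y = b) :
    ⟪y - b, x - b⟫ ∈ Icc 0 (‖x - b‖ ^ 2) := by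
  rcases eq_or_ne j i with rfl | hij
  · rw [h.resolve_left (not_not.mpr rfl), sub_self, inner_zero_left]
    exact ⟨le_rfl, by positivity⟩
  have h1 := (hW i j hij.symm b hb y hy).2 i x hx
  have h2 := (hW i j hij.symm x hx y hy).2 i b hb
  rw [← sub_sub_sub_cancel_right y x b, ← neg_sub x b, inner_neg_right, inner_sub_left,
    real_inner_self_eq_norm_sq] at h2
  exact ⟨h1, by linarith⟩

theorem IsDoubleNormalFamily.abs_inner_le_sq (hW : IsDoubleNormalFamily W) {i j l : ι}
    {b x y z : E} (hb : b ∈ W i) (hx : x ∈ W i) (hy : y ∈ W j) (hz : z ∈ W l)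
    (hyb : j ≠ i ∨ y = b) (hzb : l ≠ i ∨ z = b) : |⟪x - b, y - z⟫| ≤ ‖x - b‖ ^ 2 := by
  obtain ⟨h1, h2⟩ := hW.inner_mem_Icc hb hx hy hyb
  obtain ⟨h3, h4⟩ := hW.inner_mem_Icc hb hx hz hzb
  rw [real_inner_comm, ← sub_sub_sub_cancel_right y z b, inner_sub_left, abs_le]
  constructor <;> linarith

theorem IsDoubleNormalFamily.abs_inner_le_sq_of_ne (hW : IsDoubleNormalFamily W) {i j l m : ι}
    {x z p q : E} (hx : x ∈ W l) (hz : z ∈ W m) (hp : p ∈ W i) (hq : q ∈ W j) (hij : i ≠ j) :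
    |⟪x - z, q - p⟫| ≤ ‖q - p‖ ^ 2 := by
  have key : ∀ n, ∀ y ∈ W n, 0 ≤ ⟪q - p, y - p⟫ ∧ ⟪q - p, y - p⟫ ≤ ‖q - p‖ ^ 2 := by
    intro n y hy
    have h1 := (hW i j hij p hp q hq).2 n y hy
    have h2 := (hW j i hij.symm q hq p hp).2 n y hy
    rw [← neg_sub q p, ← sub_sub_sub_cancel_right y q p, inner_neg_left, inner_sub_right,
      real_inner_self_eq_norm_sq] at h2
    exact ⟨h1, by linarith⟩
  obtain ⟨h1, h2⟩ := key l x hx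
  obtain ⟨h3, h4⟩ := key m z hz
  rw [real_inner_comm, ← sub_sub_sub_cancel_right x z p, inner_sub_right, abs_le]
  constructor <;> linarith

theorem abs_inner_direction_le {ε : ℝ} {v w : E} (hv : v ≠ 0) (hw : w ≠ 0)
    (h : ScaleSeparated ε ‖v‖ ‖w‖) (h1 : |⟪v, w⟫| ≤ ‖v‖ ^ 2) (h2 : |⟪v, w⟫| ≤ ‖w‖ ^ 2) :
    |⟪direction v, direction w⟫| ≤ ε := by
  have hv' := norm_pos_iff.mpr hv
  have hw' := norm_pos_iff.mpr hw
  rw [inner_direction, abs_mul, abs_mul, abs_of_pos (inv_pos.mpr hv'),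
    abs_of_pos (inv_pos.mpr hw'), inv_mul_le_iff₀ hv', inv_mul_le_iff₀ hw']
  rcases h with h | h
  · nlinarith
  · nlinarith

/-- Large double-normal families contain transversals `b` and points `x i` in the same set as `b i`
such that the directions of `x i - b i` are almost orthogonal to each other and to those of
`b j - b l`. The inner products of these vectors are at most the square of either length, so
separated lengths make the angles almost right. -/
theorem exists_almost_orthogonal_directions [FiniteDimensional ℝ E] [Fintype ι] {ε : ℝ}
    (hε : 0 < ε) : ∃ N : ℕ, ∀ W : ι → Finset E, IsDoubleNormalFamily W → (∀ i, N ≤ (W i).card) →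
      ∃ b x : ι → E, IsNonObtuse b ∧ Function.Injective b ∧ (∀ i, x i ≠ b i) ∧
        (∀ i j, i ≠ j → |⟪direction (x i - b i), direction (x j - b j)⟫| ≤ ε) ∧
        (∀ i j l, j ≠ l → |⟪direction (x i - b i), direction (b j - b l)⟫| ≤ ε) := by
  obtain ⟨N, hN⟩ := exists_scaleSeparated_pairs (E := E) (ι := ι) hε
  refine ⟨N, fun W hW hcard => ?_⟩
  obtain ⟨b, x, hb, hx, hxb, hsep, hsep'⟩ := hN W hcard
  have hinj : Function.Injective b := by
    intro i j hij
    by_contra h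
    exact (hW i j h _ (hb i) _ (hb j)).1 hij
  have hself : ∀ i j, j ≠ i ∨ b j = b i := fun i j => by
    rcases eq_or_ne j i with rfl | h
    · exact Or.inr rfl
    · exact Or.inl h
  refine ⟨b, x, hW.isNonObtuse hb, hinj, hxb, fun i j hij => ?_, fun i j l hjl => ?_⟩
  · refine abs_inner_direction_le (sub_ne_zero.mpr (hxb i)) (sub_ne_zero.mpr (hxb j)) (hsep' i j hij)
      (hW.abs_inner_le_sq (hb i) (hx i) (hx j) (hb j) (Or.inl hij.symm) (Or.inl hij.symm)) ?_
    rw [real_inner_comm]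
    exact hW.abs_inner_le_sq (hb j) (hx j) (hx i) (hb i) (Or.inl hij) (Or.inl hij)
  · exact abs_inner_direction_le (sub_ne_zero.mpr (hxb i)) (sub_ne_zero.mpr (hinj.ne hjl))
      (hsep i j l) (hW.abs_inner_le_sq (hb i) (hx i) (hb j) (hb l) (hself i j) (hself i l))
      (hW.abs_inner_le_sq_of_ne (hx i) (hb i) (hb l) (hb j) hjl.symm)

end Family

section Orders

open Module Set Filter Topology

/-- The vectors are limits of the almost orthogonal directions found in larger and larger parts. -/
theorem exists_unit_vectors {d k : ℕ} (hk : k ∈ multipartiteOrders d) :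
    ∃ u : Fin k → Fin k → EuclideanSpace ℝ (Fin d),
      (∀ i j, ‖u i j‖ = 1) ∧ (∀ i j, i ≠ j → ⟪u i i, u j j⟫ = 0) ∧
      (∀ i j l, j ≠ l → ⟪u i i, u j l⟫ = 0) ∧ k ≤ 2 ^ finrank ℝ (offDiagSpan u) := by
  have hconf : ∀ n : ℕ, ∃ b x : Fin k → EuclideanSpace ℝ (Fin d), IsNonObtuse b ∧
      Function.Injective b ∧ (∀ i, x i ≠ b i) ∧
      (∀ i j, i ≠ j → |⟪direction (x i - b i), direction (x j - b j)⟫| ≤ 1 / ((n : ℝ) + 1)) ∧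
      (∀ i j l, j ≠ l →
        |⟪direction (x i - b i), direction (b j - b l)⟫| ≤ 1 / ((n : ℝ) + 1)) := by
    intro n
    obtain ⟨N, hN⟩ := exists_almost_orthogonal_directions (E := EuclideanSpace ℝ (Fin d))
      (ι := Fin k) (Nat.one_div_pos_of_nat (α := ℝ) (n := n))
    obtain ⟨W, hW, hcard⟩ := exists_isDoubleNormalFamily hk N
    exact hN W hW fun i => (hcard i).ge
  choose b x hb hinj hxb horth horth' using hconf
  let U : ℕ → Fin k → Fin k → EuclideanSpace ℝ (Fin d) := fun n i j =>
    if i = j then direction (x n i - b n i) else direction (b n i - b n j)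
  have hUdiag : ∀ n i, U n i i = direction (x n i - b n i) := fun n i => if_pos rfl
  have hUoff : ∀ n i j, i ≠ j → U n i j = direction (b n i - b n j) := fun n i j h => if_neg h
  have hUnorm : ∀ n i j, ‖U n i j‖ = 1 := by
    intro n i j
    rcases eq_or_ne i j with rfl | h
    · rw [hUdiag]
      exact norm_direction (sub_ne_zero.mpr (hxb n i))
    · rw [hUoff n i j h]
      exact norm_direction (sub_ne_zero.mpr ((hinj n).ne h))
  obtain ⟨u, -, φ, hφ, hlim⟩ := (isCompact_closedBall
    (0 : Fin k → Fin k → EuclideanSpace ℝ (Fin d)) 1).tendsto_subseq (x := U) (fun n => by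
      rw [mem_closedBall_zero_iff]
      refine (pi_norm_le_iff_of_nonneg zero_le_one).mpr fun i => ?_
      exact (pi_norm_le_iff_of_nonneg zero_le_one).mpr fun j => (hUnorm n i j).le)
  have hu : ∀ i j, Tendsto (fun n => U (φ n) i j) atTop (𝓝 (u i j)) := fun i j =>
    tendsto_pi_nhds.mp (tendsto_pi_nhds.mp hlim i) j
  have hε : Tendsto (fun n => 1 / ((φ n : ℝ) + 1)) atTop (𝓝 0) :=
    tendsto_one_div_add_atTop_nhds_zero_nat.comp hφ.tendsto_atTop
  have hzero : ∀ i j m l, (∀ n, |⟪U n i j, U n m l⟫| ≤ 1 / ((n : ℝ) + 1)) →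
      ⟪u i j, u m l⟫ = 0 := fun i j m l h =>
    tendsto_nhds_unique ((hu i j).inner (hu m l)) (squeeze_zero_norm (fun n => h (φ n)) hε)
  refine ⟨u, fun i j => ?_, fun i j hij => hzero _ _ _ _ fun n => ?_,
    fun i j l hjl => hzero _ _ _ _ fun n => ?_, ?_⟩
  · refine tendsto_nhds_unique (hu i j).norm ?_
    simp [hUnorm]
  · rw [hUdiag, hUdiag]
    exact horth n i j hij
  · rw [hUdiag, hUoff n j l hjl]
    exact horth' n i j l hjl
  · have := card_le_two_pow_of_tendsto_direction k (Fintype.card_fin k) (fun n => b (φ n)) u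
      (fun n => hb _) (fun n => hinj _) fun s l hsl =>
        (hu s l).congr fun n => hUoff (φ n) s l hsl
    rwa [Fintype.card_fin] at this

theorem add_finrank_offDiagSpan_le {d k : ℕ} {u : Fin k → Fin k → EuclideanSpace ℝ (Fin d)}
    (hnorm : ∀ i j, ‖u i j‖ = 1) (horth : ∀ i j, i ≠ j → ⟪u i i, u j j⟫ = 0)
    (horth' : ∀ i j l, j ≠ l → ⟪u i i, u j l⟫ = 0) :
    k + finrank ℝ (offDiagSpan u) ≤ d := by
  have hon : Orthonormal ℝ fun i => u i i := ⟨fun i => hnorm i i, fun i j hij => horth i j hij⟩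
  have hdiag : finrank ℝ (Submodule.span ℝ (range fun i => u i i)) = k := by
    rw [finrank_span_eq_card hon.linearIndependent, Fintype.card_fin]
  have hperp : Submodule.span ℝ (range fun i => u i i) ⟂ offDiagSpan u := by
    rw [offDiagSpan, Submodule.isOrtho_span]
    rintro _ ⟨i, rfl⟩ _ ⟨j, l, hjl, rfl⟩
    exact horth' i j l hjl
  have hsup := Submodule.finrank_sup_add_finrank_inf_eq
    (Submodule.span ℝ (range fun i => u i i)) (offDiagSpan u)
  rw [hperp.disjoint.eq_bot, finrank_bot, add_zero, hdiag] at hsup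
  rw [← hsup]
  exact (Submodule.finrank_le _).trans finrank_euclideanSpace_fin.le

/-! ### The value `k(d)` and non-obtuse configurations in a cube -/

/-- Vertices of the cube `{0, 1}ⁿ` form only non-obtuse angles. -/
theorem nonObtuseDim_le {m n : ℕ} (h : m ≤ 2 ^ n) : nonObtuseDim m ≤ n := by
  obtain ⟨f⟩ : Nonempty (Fin m ↪ (Fin n → Bool)) :=
    Function.Embedding.nonempty_of_card_le (by simpa using h)
  refine (nonObtuseDim_isLeast m).2
    ⟨fun i => WithLp.toLp 2 fun c => if f i c then 1 else 0, fun i j hij => ?_,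
      fun i j l _ _ _ => ?_⟩
  · refine f.injective (funext fun c => ?_)
    have := congrArg (fun v : EuclideanSpace ℝ (Fin n) => v c) hij
    by_cases h1 : f i c <;> by_cases h2 : f j c <;> simp_all
  · unfold EuclideanGeometry.angle
    rw [InnerProductGeometry.angle, Real.arccos_le_pi_div_two]
    refine div_nonneg ?_ (by positivity)
    rw [PiLp.inner_apply]
    refine Finset.sum_nonneg fun c _ => ?_
    by_cases h1 : f i c <;> by_cases h2 : f j c <;> by_cases h3 : f l c <;> simp [h1, h2, h3]

theorem isGreatest_kDoubleNormal (d : ℕ) : IsGreatest (multipartiteOrders d) (kDoubleNormal d) := by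
  have hbdd : BddAbove (multipartiteOrders d) := by
    refine ⟨d, fun k hk => ?_⟩
    obtain ⟨u, h1, h2, h3, -⟩ := exists_unit_vectors hk
    exact (Nat.le_add_right _ _).trans (add_finrank_offDiagSpan_le h1 h2 h3)
  have hne : (multipartiteOrders d).Nonempty :=
    ⟨0, fun r => ⟨∅, ⟨⟨⟨fun v => v.1.elim0, fun {v} => v.1.elim0⟩, fun v => v.1.elim0⟩⟩⟩⟩
  exact ⟨Nat.sSup_mem hne hbdd, fun k hk => le_csSup hbdd hk⟩

end Orders

theorem theorem4 (d : ℕ) (hd : 1 ≤ d) :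
    IsGreatest (multipartiteOrders d) (kDoubleNormal d) ∧
    (∃ u : Fin (kDoubleNormal d) → Fin (kDoubleNormal d) → EuclideanSpace ℝ (Fin d),
      (∀ i j, ‖u i j‖ = 1) ∧
      (∀ i j, i ≠ j → ⟪u i i, u j j⟫ = 0) ∧
      (∀ i j l, j ≠ l → ⟪u i i, u j l⟫ = 0) ∧
      Real.logb 2 (kDoubleNormal d) ≤
        (Module.finrank ℝ
          (Submodule.span ℝ {v | ∃ s l, s ≠ l ∧ v = u s l}) : ℝ)) ∧
    kDoubleNormal d + nonObtuseDim (kDoubleNormal d) ≤ d ∧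
    (kDoubleNormal d : ℝ) + Real.logb 2 (kDoubleNormal d) ≤ d := by
  have hgr := isGreatest_kDoubleNormal d
  obtain ⟨u, hnorm, horth, horth', hcard⟩ := exists_unit_vectors hgr.1
  have hdim := add_finrank_offDiagSpan_le hnorm horth horth'
  have hlog : Real.logb 2 (kDoubleNormal d) ≤ (Module.finrank ℝ (offDiagSpan u) : ℝ) := by
    -- The junk value `logb 2 0 = 0` makes the bound true for `0` as well.
    rcases (kDoubleNormal d).eq_zero_or_pos with h0 | hpos
    · simp [h0]
    · rw [Real.logb_le_iff_le_rpow one_lt_two (by exact_mod_cast hpos), Real.rpow_natCast]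
      exact_mod_cast hcard
  refine ⟨hgr, ⟨u, hnorm, horth, horth', hlog⟩, ?_, ?_⟩
  · exact (Nat.add_le_add_left (nonObtuseDim_le hcard) _).trans hdim
  · exact (add_le_add_right hlog _).trans (by exact_mod_cast hdim)
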